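/- All spaces are complex. An operator space is a closed linear subspace $X$ of the space $\mathcal L(H)$ of bounded operators on some Hilbert space $H$; a matrix $(x_{ij})\in M_k(X)$ is normed as an operator on the $\ell^2$-sum of $k$ copies of $H$. For a linear map $T:X\to Z$ between operator spaces let $\|T\|_k$ be the norm of the map $(x_{ij})\mapsto (Tx_{ij})$ from $M_k(X)$ to $M_k(Z)$, and put $\|T\|_{cb}=\sup_{k}\|T\|_k$; $T$ is completely bounded if $\|T\|_{cb}<\infty$. For $\lambda\ge 1$, an operator space $Z$ has the $\lambda$-Complete Separable Extension Property ($\lambda$-CSEP) if for every separable operator space $Y$, every closed linear subspace $X$ of $Y$ and every completely bounded $T:X\to Z$ there is a completely bounded $\tilde T:Y\to Z$ extending $T$ with $\|\tilde T\|_{cb}\le\lambda\|T\|_{cb}$. Let $M_n$ denote the $n\times n$ complex matrices, regarded as $\mathcal L(\ell^2_n)$, and let $c_0(M_n)$ be the space of all sequences $(a_j)_{j}$ in $M_n$ with $\|a_j\|\to 0$, regarded as an operator space of block diagonal operators $(\xi_j)_j\mapsto(a_j\xi_j)_j$ on $\ell^2(\mathbb N;\ell^2_n)$ (so its norm is $\sup_j\|a_j\|$).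 **Corollary.** For every $n$, $c_0(M_n)$ has the $2$-CSEP. -/

import Mathlib

open Filter Topology
open scoped ENNReal NNReal

universe u v

/- Operator spaces are closed complex-linear subspaces of the bounded operators `H →L[ℂ] H`
on a complex Hilbert space `H`. -/

namespace OpSpace

section Matrices

variable {H : Type u} [NormedAddCommGroup H] [InnerProductSpace ℂ H]

/-- The operator on the Hilbert space sum `ℓ²_k(H)` of `k` copies of `H` given by a `k × k` matrix
of bounded operators on `H`: `(x ξ) i = ∑ j, x i j (ξ j)`. -/
noncomputable def matOp {k : ℕ} (x : Matrix (Fin k) (Fin k) (H →L[ℂ] H)) :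
    PiLp 2 (fun _ : Fin k => H) →L[ℂ] PiLp 2 (fun _ : Fin k => H) :=
  ((PiLp.continuousLinearEquiv 2 ℂ (fun _ : Fin k => H)).symm :
      (Fin k → H) →L[ℂ] PiLp 2 (fun _ : Fin k => H)) ∘L
    ContinuousLinearMap.pi
      (fun i => ∑ j, (x i j) ∘L (PiLp.proj 2 (fun _ : Fin k => H) j))

theorem matOp_apply {k : ℕ} (x : Matrix (Fin k) (Fin k) (H →L[ℂ] H))
    (ξ : PiLp 2 (fun _ : Fin k => H)) (i : Fin k) :
    matOp x ξ i = ∑ j, x i j (ξ j) := by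
  simp [matOp]

/-- The norm of a `k × k` matrix with entries in a subspace `X` of `H →L[ℂ] H`, namely its operator
norm on `ℓ²_k(H)`. -/
noncomputable def matNorm {X : Submodule ℂ (H →L[ℂ] H)} {k : ℕ}
    (x : Matrix (Fin k) (Fin k) X) : ℝ :=
  ‖matOp (x.map (fun a => (a : H →L[ℂ] H)))‖

end Matrices

section CompletelyBounded

variable {H : Type u} [NormedAddCommGroup H] [InnerProductSpace ℂ H]
  {K : Type v} [NormedAddCommGroup K] [InnerProductSpace ℂ K]
  {X : Submodule ℂ (H →L[ℂ] H)} {Z : Submodule ℂ (K →L[ℂ] K)}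

/-- `‖T‖_k`: the norm of the amplification `(x i j) ↦ (T (x i j))` of `T` to `k × k` matrices,
with value `∞` if the amplification is unbounded. -/
noncomputable def ampNorm (T : X →ₗ[ℂ] Z) (k : ℕ) : ℝ≥0∞ :=
  ⨆ (x : Matrix (Fin k) (Fin k) X) (_ : matNorm x ≤ 1), ENNReal.ofReal (matNorm (x.map T))

/-- The completely bounded norm `‖T‖_cb = sup_k ‖T‖_k`, with value `∞` if `T` is not completely
bounded. -/
noncomputable def cbNorm (T : X →ₗ[ℂ] Z) : ℝ≥0∞ := ⨆ k : ℕ, ampNorm T k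

/-- `T` is completely bounded. -/
def CompletelyBounded (T : X →ₗ[ℂ] Z) : Prop := cbNorm T < ∞

end CompletelyBounded

/-- The `c`-Complete Separable Extension Property (`c`-CSEP) of an operator space `Z`: whenever `Y`
is a separable operator space, `X` a closed subspace of `Y` and `T : X → Z` is completely
bounded, there is a completely bounded `T' : Y → Z` that extends `T` and satisfies
`‖T'‖_cb ≤ c ‖T‖_cb`. -/
def HasCSEP {K : Type v} [NormedAddCommGroup K] [InnerProductSpace ℂ K]
    (c : ℝ≥0) (Z : Submodule ℂ (K →L[ℂ] K)) : Prop :=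
  ∀ (H : Type u) [NormedAddCommGroup H] [InnerProductSpace ℂ H] [CompleteSpace H]
    (Y : Submodule ℂ (H →L[ℂ] H)) (_ : IsClosed (Y : Set (H →L[ℂ] H)))
    (_ : TopologicalSpace.SeparableSpace Y)
    (X : Submodule ℂ (H →L[ℂ] H)) (_ : IsClosed (X : Set (H →L[ℂ] H))) (hXY : X ≤ Y)
    (T : X →ₗ[ℂ] Z), CompletelyBounded T →
      ∃ T' : Y →ₗ[ℂ] Z, (∀ x : X, T' (Submodule.inclusion hXY x) = T x) ∧
        CompletelyBounded T' ∧ cbNorm T' ≤ (c : ℝ≥0∞) * cbNorm T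

section CZero

variable {H : Type u} [NormedAddCommGroup H] [InnerProductSpace ℂ H]

/-- `c₀(Z)` for an operator space `Z` of operators on `H`: the sequences `(a j)` in `Z` with
`‖a j‖ → 0`, regarded as the block diagonal operators `ξ ↦ (a j (ξ j))_j` on `ℓ²(ℕ; H)`. -/
noncomputable def cZero (Z : Submodule ℂ (H →L[ℂ] H)) :
    Submodule ℂ (lp (fun _ : ℕ => H) 2 →L[ℂ] lp (fun _ : ℕ => H) 2) where
  carrier := {S | ∃ a : ℕ → (H →L[ℂ] H), (∀ j, a j ∈ Z) ∧ Tendsto (fun j => ‖a j‖) atTop (𝓝 0) ∧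
    ∀ (ξ : lp (fun _ : ℕ => H) 2) (j : ℕ), S ξ j = a j (ξ j)}
  zero_mem' := ⟨fun _ => 0, fun _ => Z.zero_mem, by simp, by simp⟩
  add_mem' := by
    rintro S S' ⟨a, ha, ha0, hS⟩ ⟨b, hb, hb0, hS'⟩
    refine ⟨fun j => a j + b j, fun j => Z.add_mem (ha j) (hb j), ?_, fun ξ j => ?_⟩
    · rw [← tendsto_zero_iff_norm_tendsto_zero] at *
      simpa using ha0.add hb0
    · simp [hS, hS']
  smul_mem' := by
    rintro c S ⟨a, ha, ha0, hS⟩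
    refine ⟨fun j => c • a j, fun j => Z.smul_mem c (ha j), ?_, fun ξ j => ?_⟩
    · rw [← tendsto_zero_iff_norm_tendsto_zero] at *
      simpa using ha0.const_smul c
    · simp [hS]

/-- Every null sequence in `Z` is an element of `c₀(Z)`. -/
theorem exists_mem_cZero (Z : Submodule ℂ (H →L[ℂ] H)) (a : ℕ → H →L[ℂ] H)
    (ha : ∀ j, a j ∈ Z) (h0 : Tendsto (fun j => ‖a j‖) atTop (𝓝 0)) :
    ∃ S ∈ cZero Z, ∀ (ξ : lp (fun _ : ℕ => H) 2) (j : ℕ), S ξ j = a j (ξ j) := by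
  obtain ⟨C, hC⟩ := h0.bddAbove_range
  have hC' : ∀ j, ‖a j‖ ≤ C := fun j => hC ⟨j, rfl⟩
  have hC0 : 0 ≤ C := (norm_nonneg _).trans (hC' 0)
  have hle : ∀ (ξ : lp (fun _ : ℕ => H) 2) j,
      ‖a j (ξ j)‖ ≤ ‖(((C : ℂ) • ξ : lp (fun _ : ℕ => H) 2) : ∀ _, H) j‖ := by
    intro ξ j
    refine ((a j).le_opNorm _).trans ?_
    rw [lp.coeFn_smul, Pi.smul_apply, norm_smul, Complex.norm_real, Real.norm_of_nonneg hC0]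
    gcongr
    exact hC' j
  have hm : ∀ ξ : lp (fun _ : ℕ => H) 2, Memℓp (fun j => a j (ξ j)) 2 := by
    intro ξ
    have := lp.memℓp ((C : ℂ) • ξ)
    rw [memℓp_gen_iff (by norm_num)] at this ⊢
    refine this.of_nonneg_of_le (fun j => by positivity) (fun j => ?_)
    gcongr
    exact hle ξ j
  let L : lp (fun _ : ℕ => H) 2 →ₗ[ℂ] lp (fun _ : ℕ => H) 2 :=
    { toFun := fun ξ => ⟨_, hm ξ⟩
      map_add' := fun x y => by
        ext j
        simp only [lp.coeFn_add, Pi.add_apply, map_add]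
      map_smul' := fun c x => by ext j; simp }
  let S := L.mkContinuous C (fun ξ => by
    have : ‖L ξ‖ ≤ ‖(C : ℂ) • ξ‖ := lp.norm_mono (by norm_num) (hle ξ)
    rwa [norm_smul, Complex.norm_real, Real.norm_of_nonneg hC0] at this)
  exact ⟨S, ⟨a, ha, h0, fun ξ j => rfl⟩, fun ξ j => rfl⟩

theorem isClosed_blockDiagonal {E : Type v} [NormedAddCommGroup E] [NormedSpace ℂ E]
    (Z : Submodule ℂ (H →L[ℂ] H)) (hZ : IsClosed (Z : Set (H →L[ℂ] H)))
    (p : ℕ → E →L[ℂ] H) (i : ℕ → H →L[ℂ] E) (hp : ∀ j, ‖p j‖ ≤ 1) (hi : ∀ j, ‖i j‖ ≤ 1)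
    (hpi : ∀ j v, p j (i j v) = v) :
    IsClosed {S : E →L[ℂ] E | ∃ a : ℕ → (H →L[ℂ] H), (∀ j, a j ∈ Z) ∧
      Tendsto (fun j => ‖a j‖) atTop (𝓝 0) ∧ ∀ ξ j, p j (S ξ) = a j (p j ξ)} := by
  let D : ℕ → (E →L[ℂ] E) → (H →L[ℂ] H) := fun j S => (p j) ∘L S ∘L (i j)
  have hDn : ∀ j S S', ‖D j S - D j S'‖ ≤ ‖S - S'‖ := by
    intro j S S'
    have h1 : D j S - D j S' = (p j) ∘L (S - S') ∘L (i j) := by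
      ext v
      simp [D]
    rw [h1]
    calc _ ≤ ‖p j‖ * (‖S - S'‖ * ‖i j‖) := (ContinuousLinearMap.opNorm_comp_le _ _).trans
            (by gcongr; exact ContinuousLinearMap.opNorm_comp_le _ _)
      _ ≤ 1 * (‖S - S'‖ * 1) := by gcongr; exacts [hp j, hi j]
      _ = ‖S - S'‖ := by ring
  refine isClosed_of_closure_subset (fun S hS => ?_)
  obtain ⟨s, hs, hlim⟩ := mem_closure_iff_seq_limit.1 hS
  choose a haZ ha0 ha using hs
  have haD : ∀ m j, D j (s m) = a m j := by
    intro m j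
    ext v
    simp [D, ha, hpi]
  have hn : Tendsto (fun m => ‖s m - S‖) atTop (𝓝 0) := tendsto_iff_norm_sub_tendsto_zero.1 hlim
  have hDlim : ∀ j, Tendsto (fun m => a m j) atTop (𝓝 (D j S)) := by
    intro j
    rw [tendsto_iff_norm_sub_tendsto_zero]
    refine squeeze_zero (fun _ => norm_nonneg _) (fun m => ?_) hn
    rw [← haD]
    exact hDn j _ _
  refine ⟨fun j => D j S, fun j => hZ.mem_of_tendsto (hDlim j)
    (Eventually.of_forall fun m => haZ m j), ?_, fun ξ j => ?_⟩
  · rw [Metric.tendsto_atTop]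
    intro ε hε
    obtain ⟨m, hm⟩ := (hn.eventually (gt_mem_nhds (half_pos hε))).exists
    obtain ⟨N, hN⟩ := Metric.tendsto_atTop.1 (ha0 m) (ε / 2) (half_pos hε)
    refine ⟨N, fun j hj => ?_⟩
    have h1 := hN j hj
    have h2 := hDn j S (s m)
    rw [haD, norm_sub_rev S] at h2
    simp only [dist_zero_right, norm_norm] at h1 ⊢
    have h3 := norm_le_norm_add_norm_sub' (D j S) (a m j)
    linarith
  · have h1 : Tendsto (fun m => p j (s m ξ)) atTop (𝓝 (p j (S ξ))) := by
      have hc : Continuous fun R : E →L[ℂ] E => p j (R ξ) := by fun_prop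
      exact (hc.tendsto S).comp hlim
    have h2 : Tendsto (fun m => a m j (p j ξ)) atTop (𝓝 (D j S (p j ξ))) := by
      have hc : Continuous fun R : H →L[ℂ] H => R (p j ξ) := by fun_prop
      exact (hc.tendsto _).comp (hDlim j)
    simp only [ha] at h1
    exact tendsto_nhds_unique h1 h2

/-- `c₀(Z)` is again an operator space, that is, closed. -/
theorem isClosed_cZero (Z : Submodule ℂ (H →L[ℂ] H)) (hZ : IsClosed (Z : Set (H →L[ℂ] H))) :
    IsClosed (cZero Z : Set (lp (fun _ : ℕ => H) 2 →L[ℂ] lp (fun _ : ℕ => H) 2)) :=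
  isClosed_blockDiagonal Z hZ (fun j => lp.evalCLM ℂ (fun _ : ℕ => H) 2 j)
    (fun j => lp.singleContinuousLinearMap ℂ (fun _ : ℕ => H) 2 j)
    (fun j => ContinuousLinearMap.opNorm_le_bound _ zero_le_one (fun v => by
      rw [one_mul]
      exact lp.norm_apply_le_norm (by norm_num) v j))
    (fun j => ContinuousLinearMap.opNorm_le_bound _ zero_le_one (fun v => by
      rw [one_mul, lp.singleContinuousLinearMap_apply, lp.norm_single (by norm_num)]))
    (fun j v => by
      rw [lp.singleContinuousLinearMap_apply]
      exact lp.single_apply_self (E := fun _ : ℕ => H) 2 j v)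

end CZero

/-- `M_n`, the complex `n × n` matrices regarded as all linear operators on the `n`-dimensional
Hilbert space. -/
noncomputable def matSpace (n : ℕ) :
    Submodule ℂ (EuclideanSpace ℂ (Fin n) →L[ℂ] EuclideanSpace ℂ (Fin n)) := ⊤

end OpSpace

/-! This is Sobczyk's theorem in Veech's style, with Wittstock's extension theorem in place of
Hahn–Banach. With `c = ‖T‖_cb`, the diagonal blocks of `T` are maps `X → M_n` of cb-norm at most `c`
tending pointwise to `0`. `CBBoundedBy.exists_extension` extends each of them, with the same bound,
to a map `R j` on `Y`. The `R j` need not tend to `0` off `X`, but since `M_n` is finite-dimensional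
the maps of cb-norm at most `c` form a compact set for pointwise convergence, and every cluster
point of `R j` vanishes on `X`. Separability of `Y` makes this compact set metrizable, so
`exists_asymptotic_seq` gives `S j` in it that vanish on `X` with `R j - S j → 0` pointwise. The
differences are the blocks of the required extension; subtracting two maps bounded by `c` costs the
factor `2`.

Wittstock's theorem rests on the duality between maps `T : X → M_n` and functionals `y ↦ ∑ ⟪e q, T
(y q p) (e p)⟫` on `M_n(X)`. A cb-bound `c` for `T` amounts to domination of the real part by `c *
traceGauge`, a sublinear gauge on all of `M_n(B(H))`, so real Hahn–Banach applies. -/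

namespace OpSpace

/-! ### Operator norms of matrices through sesquilinear sums. -/

section WeakForm

variable {K : Type v} [NormedAddCommGroup K] [InnerProductSpace ℂ K]

theorem inner_matOp {k : ℕ} (M : Matrix (Fin k) (Fin k) (K →L[ℂ] K))
    (ξ η : PiLp 2 (fun _ : Fin k => K)) :
    inner ℂ η (matOp M ξ) = ∑ i, ∑ j, inner ℂ (η i) (M i j (ξ j)) := by
  simp [PiLp.inner_apply, matOp_apply, inner_sum]

/-- By AM-GM, a bound by a product of norms can be replaced by one by a sum of squares. In this form
the bound is linear in `M`, passes to pointwise limits and adds up over blocks. -/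
theorem norm_matOp_le_iff {k : ℕ} (M : Matrix (Fin k) (Fin k) (K →L[ℂ] K)) {c : ℝ} (hc : 0 ≤ c) :
    ‖matOp M‖ ≤ c ↔ ∀ ξ η : Fin k → K, (∑ i, ∑ j, inner ℂ (η i) (M i j (ξ j))).re ≤
      c / 2 * (∑ i, ‖ξ i‖ ^ 2 + ∑ i, ‖η i‖ ^ 2) := by
  constructor
  · intro h ξ η
    have key := inner_matOp M (WithLp.toLp 2 ξ) (WithLp.toLp 2 η)
    simp only at key
    rw [← key]
    have hξ := PiLp.norm_sq_eq_of_L2 (fun _ : Fin k => K) (WithLp.toLp 2 ξ)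
    have hη := PiLp.norm_sq_eq_of_L2 (fun _ : Fin k => K) (WithLp.toLp 2 η)
    simp only at hξ hη
    rw [← hξ, ← hη]
    set a := WithLp.toLp 2 ξ
    set b := WithLp.toLp 2 η
    have h1 : (inner ℂ b (matOp M a)).re ≤ ‖b‖ * ‖matOp M a‖ := re_inner_le_norm (𝕜 := ℂ) _ _
    have h2 : ‖matOp M a‖ ≤ c * ‖a‖ := (matOp M).le_of_opNorm_le h a
    have h3 : ‖b‖ * ‖matOp M a‖ ≤ ‖b‖ * (c * ‖a‖) := by gcongr
    nlinarith [mul_nonneg hc (sq_nonneg (‖a‖ - ‖b‖))]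
  · intro h
    refine ContinuousLinearMap.opNorm_le_bound _ hc fun a => ?_
    set b := matOp M a with hb
    -- Rescaling makes both test vectors have norm `‖a‖ * ‖b‖`, the equality case of AM-GM.
    have key := inner_matOp M ((‖b‖ : ℂ) • a) ((‖a‖ : ℂ) • b)
    have h1 := h (fun i => ((‖b‖ : ℂ) • a) i) (fun i => ((‖a‖ : ℂ) • b) i)
    rw [← key, ← PiLp.norm_sq_eq_of_L2, ← PiLp.norm_sq_eq_of_L2, map_smul, ← hb,
      inner_smul_left, inner_smul_right, norm_smul, norm_smul, inner_self_eq_norm_sq_to_K] at h1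
    have h2 : ‖a‖ * (‖b‖ * ‖b‖ ^ 2) ≤ c / 2 * ((‖b‖ * ‖a‖) ^ 2 + (‖a‖ * ‖b‖) ^ 2) := by
      convert h1 using 1
      · simp only [Complex.conj_ofReal, Complex.coe_algebraMap]
        norm_cast
      · simp
    rcases (norm_nonneg a).eq_or_lt with ha | ha
    · have : a = 0 := norm_eq_zero.1 ha.symm
      simp [hb, this]
    rcases (norm_nonneg b).eq_or_lt with hb0 | hb0
    · rw [← hb0]; positivity
    have h3 : (‖a‖ * ‖b‖ ^ 2) * ‖b‖ ≤ (‖a‖ * ‖b‖ ^ 2) * (c * ‖a‖) := by nlinarith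
    exact le_of_mul_le_mul_left h3 (by positivity)

theorem norm_apply_le_norm_matOp {k : ℕ} (M : Matrix (Fin k) (Fin k) (K →L[ℂ] K)) (i j : Fin k) :
    ‖M i j‖ ≤ ‖matOp M‖ := by
  refine ContinuousLinearMap.opNorm_le_bound (M i j) (norm_nonneg (matOp M)) fun v => ?_
  have h1 := (matOp M).le_opNorm (PiLp.single 2 j v)
  have h2 := PiLp.norm_apply_le (matOp M (PiLp.single 2 j v)) i
  rw [matOp_apply, Finset.sum_eq_single j (by intro b _ hb; simp [hb]) (by simp)] at h2
  simpa using h2.trans h1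

end WeakForm

/-! ### The sublinear gauge on matrices of operators. -/

section GramForm

open scoped ComplexOrder

variable {H : Type u} [NormedAddCommGroup H] [InnerProductSpace ℂ H] {n : ℕ}

/-- The quadratic form `h ↦ ⟪h, (P ⊗ 1) h⟫` on `H ^ n` associated with a complex matrix `P`. -/
noncomputable def ampForm (P : Matrix (Fin n) (Fin n) ℂ) (h : Fin n → H) : ℝ :=
  (∑ p, ∑ q, P p q * inner ℂ (h p) (h q)).re

theorem ampForm_add (P Q : Matrix (Fin n) (Fin n) ℂ) (h : Fin n → H) :
    ampForm (P + Q) h = ampForm P h + ampForm Q h := by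
  simp [ampForm, add_mul, Finset.sum_add_distrib]

theorem ampForm_smul (r : ℝ) (P : Matrix (Fin n) (Fin n) ℂ) (h : Fin n → H) :
    ampForm (r • P) h = r * ampForm P h := by
  rw [ampForm, ampForm, ← Complex.re_ofReal_mul, Finset.mul_sum]
  simp only [Matrix.smul_apply, Complex.real_smul, Finset.mul_sum, mul_assoc]

theorem ampForm_conjTranspose_mul_self {m : ℕ} (A : Matrix (Fin m) (Fin n) ℂ) (h : Fin n → H) :
    ampForm (A.conjTranspose * A) h = ∑ r, ‖∑ p, A r p • h p‖ ^ 2 := by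
  have : ((∑ r, ‖∑ p, A r p • h p‖ ^ 2 : ℝ) : ℂ) =
      ∑ p, ∑ q, (A.conjTranspose * A) p q * inner ℂ (h p) (h q) := by
    push_cast
    simp_rw [← Complex.coe_algebraMap, ← inner_self_eq_norm_sq_to_K (𝕜 := ℂ), sum_inner, inner_sum,
      inner_smul_left, inner_smul_right, Matrix.mul_apply, Matrix.conjTranspose_apply,
      Finset.sum_mul]
    rw [Finset.sum_comm]
    refine Finset.sum_congr rfl fun p _ => ?_
    rw [Finset.sum_comm]
    refine Finset.sum_congr rfl fun q _ => Finset.sum_congr rfl fun r _ => ?_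
    simp [mul_assoc]
  rw [ampForm, ← this, Complex.ofReal_re]

theorem ampForm_one (h : Fin n → H) : ampForm 1 h = ∑ r, ‖h r‖ ^ 2 := by
  have := ampForm_conjTranspose_mul_self (1 : Matrix (Fin n) (Fin n) ℂ) h
  simpa [Matrix.one_apply] using this

theorem trace_conjTranspose_mul_self_re {m : ℕ} (A : Matrix (Fin m) (Fin n) ℂ) :
    (A.conjTranspose * A).trace.re = ∑ r, ∑ p, ‖A r p‖ ^ 2 := by
  rw [Finset.sum_comm]
  simp only [Matrix.trace, Matrix.diag, Matrix.mul_apply, Matrix.conjTranspose_apply,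
    Complex.re_sum]
  refine Finset.sum_congr rfl fun p _ => Finset.sum_congr rfl fun r _ => ?_
  rw [Complex.star_def, ← Complex.normSq_eq_conj_mul_self, Complex.ofReal_re,
    Complex.normSq_eq_norm_sq]

/-- The block matrix `[P, y; y*, Q]` is positive. -/
def Dominates (P Q : Matrix (Fin n) (Fin n) ℂ) (y : Matrix (Fin n) (Fin n) (H →L[ℂ] H)) : Prop :=
  ∀ ξ η : Fin n → H, (∑ q, ∑ p, inner ℂ (η q) (y q p (ξ p))).re ≤
    (ampForm P η + ampForm Q ξ) / 2

theorem Dominates.add {P Q P' Q' : Matrix (Fin n) (Fin n) ℂ}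
    {y y' : Matrix (Fin n) (Fin n) (H →L[ℂ] H)} (h : Dominates P Q y) (h' : Dominates P' Q' y') :
    Dominates (P + P') (Q + Q') (y + y') := by
  intro ξ η
  have h1 := h ξ η
  have h2 := h' ξ η
  simp only [Matrix.add_apply, _root_.add_apply, inner_add_right,
    Finset.sum_add_distrib, Complex.add_re, ampForm_add] at *
  linarith

theorem Dominates.smul {P Q : Matrix (Fin n) (Fin n) ℂ}
    {y : Matrix (Fin n) (Fin n) (H →L[ℂ] H)} (h : Dominates P Q y) {r : ℝ} (hr : 0 ≤ r) :
    Dominates (r • P) (r • Q) (r • y) := by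
  intro ξ η
  have h1 := mul_le_mul_of_nonneg_left (h ξ η) hr
  rw [← Complex.re_ofReal_mul, Finset.mul_sum] at h1
  simp only [Finset.mul_sum] at h1
  have e : ∀ q p, inner ℂ (η q) ((r • y) q p (ξ p)) = (r : ℂ) * inner ℂ (η q) (y q p (ξ p)) := by
    intro q p
    rw [Matrix.smul_apply, _root_.smul_apply, ← Complex.coe_smul, inner_smul_right]
  simp only [e, ampForm_smul]
  linarith

/-- The values `(tr P + tr Q) / 2` over positive `P`, `Q` for which `[P, y; y*, Q]` is positive. -/
def traceValues (y : Matrix (Fin n) (Fin n) (H →L[ℂ] H)) : Set ℝ :=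
  {t | ∃ P Q : Matrix (Fin n) (Fin n) ℂ, P.PosSemidef ∧ Q.PosSemidef ∧ Dominates P Q y ∧
    t = (P.trace.re + Q.trace.re) / 2}

theorem traceValues_nonneg {y : Matrix (Fin n) (Fin n) (H →L[ℂ] H)} {t : ℝ}
    (ht : t ∈ traceValues y) : 0 ≤ t := by
  obtain ⟨P, Q, hP, hQ, -, rfl⟩ := ht
  have h1 := (Complex.le_def.1 hP.trace_nonneg).1
  have h2 := (Complex.le_def.1 hQ.trace_nonneg).1
  simp only [Complex.zero_re] at h1 h2
  positivity

theorem bddBelow_traceValues (y : Matrix (Fin n) (Fin n) (H →L[ℂ] H)) :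
    BddBelow (traceValues y) := ⟨0, fun _ => traceValues_nonneg⟩

theorem traceValues_nonempty (y : Matrix (Fin n) (Fin n) (H →L[ℂ] H)) :
    (traceValues y).Nonempty := by
  have hP : (‖matOp y‖ • (1 : Matrix (Fin n) (Fin n) ℂ)).PosSemidef :=
    Matrix.PosSemidef.one.smul (norm_nonneg (matOp y))
  refine ⟨_, _, _, hP, hP, fun ξ η => ?_, rfl⟩
  have := (norm_matOp_le_iff y (norm_nonneg (matOp y))).1 le_rfl ξ η
  rw [ampForm_smul, ampForm_smul, ampForm_one, ampForm_one]
  linarith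

/-- The infimum of `(tr P + tr Q) / 2` over positive `P`, `Q` with `[P, y; y*, Q]` positive. -/
noncomputable def traceGauge (y : Matrix (Fin n) (Fin n) (H →L[ℂ] H)) : ℝ := sInf (traceValues y)

/-- Positive block matrices add and the trace is linear; this is why the gauge is defined by `P`,
`Q` and not by factorizations of `y`. -/
theorem traceGauge_add (y y' : Matrix (Fin n) (Fin n) (H →L[ℂ] H)) :
    traceGauge (y + y') ≤ traceGauge y + traceGauge y' := by
  refine le_of_forall_pos_le_add fun ε hε => ?_
  obtain ⟨_, ⟨P, Q, hP, hQ, h, rfl⟩, ht⟩ :=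
    exists_lt_of_csInf_lt (traceValues_nonempty y) (lt_add_of_pos_right _ (half_pos hε))
  obtain ⟨_, ⟨P', Q', hP', hQ', h', rfl⟩, ht'⟩ :=
    exists_lt_of_csInf_lt (traceValues_nonempty y') (lt_add_of_pos_right _ (half_pos hε))
  have := csInf_le (bddBelow_traceValues (y + y'))
    ⟨_, _, hP.add hP', hQ.add hQ', h.add h', rfl⟩
  simp only [Matrix.trace_add, Complex.add_re] at this
  unfold traceGauge at *
  linarith

theorem traceGauge_smul_le (y : Matrix (Fin n) (Fin n) (H →L[ℂ] H)) {r : ℝ} (hr : 0 < r) :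
    traceGauge (r • y) ≤ r * traceGauge y := by
  rw [← div_le_iff₀' hr]
  refine le_csInf (traceValues_nonempty y) ?_
  rintro _ ⟨P, Q, hP, hQ, h, rfl⟩
  rw [div_le_iff₀' hr]
  refine csInf_le (bddBelow_traceValues _)
    ⟨_, _, hP.smul hr.le, hQ.smul hr.le, h.smul hr.le, ?_⟩
  simp only [Matrix.trace_smul, Complex.real_smul, Complex.re_ofReal_mul]
  ring

theorem traceGauge_smul (y : Matrix (Fin n) (Fin n) (H →L[ℂ] H)) {r : ℝ} (hr : 0 < r) :
    traceGauge (r • y) = r * traceGauge y := by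
  refine (traceGauge_smul_le y hr).antisymm ?_
  have := traceGauge_smul_le (r • y) (inv_pos.2 hr)
  rwa [smul_smul, inv_mul_cancel₀ hr.ne', one_smul, ← div_eq_inv_mul, le_div_iff₀' hr] at this

end GramForm


/-! ### Factorizations `A* x B` and positive block matrices. -/

section Sandwich

variable {k m n : ℕ} {W : Type*} [AddCommGroup W] [Module ℂ W]

/-- The matrix product `A* x B` of a matrix `x` over a vector space with scalar matrices. -/
def sandwich (A : Matrix (Fin k) (Fin n) ℂ) (x : Matrix (Fin k) (Fin k) W)
    (B : Matrix (Fin k) (Fin n) ℂ) : Matrix (Fin n) (Fin n) W :=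
  fun q p => ∑ i, ∑ j, (star (A i q) * B j p) • x i j

theorem sandwich_sandwich (A B : Matrix (Fin k) (Fin n) ℂ) (A' B' : Matrix (Fin m) (Fin k) ℂ)
    (y : Matrix (Fin m) (Fin m) W) :
    sandwich A (sandwich A' y B') B = sandwich (A' * A) y (B' * B) := by
  ext q p
  simp only [sandwich, Matrix.mul_apply, star_sum, star_mul', Finset.sum_mul, Finset.mul_sum,
    Finset.smul_sum, Finset.sum_smul, smul_smul]
  calc _ = ∑ i, ∑ r, ∑ j, ∑ s, (star (A i q) * B j p * (star (A' r i) * B' s j)) • y r s :=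
        Finset.sum_congr rfl fun i _ => Finset.sum_comm
    _ = ∑ r, ∑ i, ∑ s, ∑ j, (star (A i q) * B j p * (star (A' r i) * B' s j)) • y r s := by
        rw [Finset.sum_comm]
        exact Finset.sum_congr rfl fun r _ => Finset.sum_congr rfl fun i _ => Finset.sum_comm
    _ = ∑ r, ∑ s, ∑ i, ∑ j, (star (A i q) * B j p * (star (A' r i) * B' s j)) • y r s :=
        Finset.sum_congr rfl fun r _ => Finset.sum_comm
    _ = _ := by
        refine Finset.sum_congr rfl fun r _ => Finset.sum_congr rfl fun s _ => ?_
        rw [Finset.sum_comm]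
        refine Finset.sum_congr rfl fun i _ => Finset.sum_congr rfl fun j _ => ?_
        congr 1
        ring

theorem sandwich_one (y : Matrix (Fin n) (Fin n) W) : sandwich 1 y 1 = y := by
  ext q p
  simp [sandwich, Matrix.one_apply, ite_smul, apply_ite]

theorem sandwich_map {V : Type*} [AddCommGroup V] [Module ℂ V] (T : W →ₗ[ℂ] V)
    (A : Matrix (Fin k) (Fin n) ℂ) (x : Matrix (Fin k) (Fin k) W) (B : Matrix (Fin k) (Fin n) ℂ) :
    (sandwich A x B).map T = sandwich A (x.map T) B := by
  ext q p
  simp [sandwich]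

variable {H : Type u} [NormedAddCommGroup H] [InnerProductSpace ℂ H]

theorem sum_inner_sandwich (A B : Matrix (Fin k) (Fin n) ℂ)
    (x : Matrix (Fin k) (Fin k) (H →L[ℂ] H)) (ξ η : Fin n → H) :
    ∑ q, ∑ p, inner ℂ (η q) (sandwich A x B q p (ξ p)) =
      ∑ i, ∑ j, inner ℂ (∑ q, A i q • η q) (x i j (∑ p, B j p • ξ p)) := by
  simp only [sandwich, _root_.sum_apply, _root_.smul_apply, map_sum, map_smul,
    inner_sum, sum_inner, inner_smul_left, inner_smul_right, Finset.mul_sum]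
  calc _ = ∑ q, ∑ i, ∑ p, ∑ j, star (A i q) * B j p * inner ℂ (η q) (x i j (ξ p)) :=
        Finset.sum_congr rfl fun i _ => Finset.sum_comm
    _ = ∑ i, ∑ q, ∑ j, ∑ p, star (A i q) * B j p * inner ℂ (η q) (x i j (ξ p)) := by
        rw [Finset.sum_comm]
        exact Finset.sum_congr rfl fun r _ => Finset.sum_congr rfl fun i _ => Finset.sum_comm
    _ = ∑ i, ∑ j, ∑ q, ∑ p, star (A i q) * B j p * inner ℂ (η q) (x i j (ξ p)) :=
        Finset.sum_congr rfl fun r _ => Finset.sum_comm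
    _ = _ := by
        refine Finset.sum_congr rfl fun r _ => Finset.sum_congr rfl fun s _ => ?_
        rw [Finset.sum_comm]
        refine Finset.sum_congr rfl fun i _ => Finset.sum_congr rfl fun j _ => ?_
        simp only [Complex.star_def]
        ring

theorem dominates_sandwich (A B : Matrix (Fin k) (Fin n) ℂ)
    (x : Matrix (Fin k) (Fin k) (H →L[ℂ] H)) (hx : ‖matOp x‖ ≤ 1) :
    Dominates (A.conjTranspose * A) (B.conjTranspose * B) (sandwich A x B) := by
  intro ξ η
  rw [sum_inner_sandwich, ampForm_conjTranspose_mul_self, ampForm_conjTranspose_mul_self]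
  have := (norm_matOp_le_iff x zero_le_one).1 hx (fun j => ∑ p, B j p • ξ p)
    (fun i => ∑ q, A i q • η q)
  linarith

theorem sum_smul_sum_smul (C : Matrix (Fin m) (Fin k) ℂ) (A : Matrix (Fin k) (Fin n) ℂ)
    (h : Fin n → W) (r : Fin m) :
    ∑ p, C r p • ∑ i, A p i • h i = ∑ i, (C * A) r i • h i := by
  simp only [Finset.smul_sum, smul_smul, Matrix.mul_apply, Finset.sum_smul]
  exact Finset.sum_comm

/-- Converse to `dominates_sandwich` for invertible factors: testing domination on `B ξ` and `A η`
turns the two forms into `∑ ‖ξ i‖ ^ 2` and `∑ ‖η i‖ ^ 2`. -/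
theorem norm_matOp_sandwich_le {y : Matrix (Fin n) (Fin n) (H →L[ℂ] H)}
    {A B C D : Matrix (Fin n) (Fin n) ℂ}
    (h : Dominates (C.conjTranspose * C) (D.conjTranspose * D) y) (hA : C * A = 1)
    (hB : D * B = 1) : ‖matOp (sandwich A y B)‖ ≤ 1 := by
  rw [norm_matOp_le_iff _ zero_le_one]
  intro ξ η
  have h1 := h (fun j => ∑ p, B j p • ξ p) (fun i => ∑ q, A i q • η q)
  simp only [ampForm_conjTranspose_mul_self, sum_smul_sum_smul, hA, hB, Matrix.one_apply,
    ite_smul, one_smul, zero_smul, Finset.sum_ite_eq, Finset.mem_univ, if_true] at h1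
  rw [sum_inner_sandwich]
  linarith

end Sandwich

/-! ### Wittstock's extension theorem for maps into `M_n`. -/

section Extension

variable {k n : ℕ}

/-- The contraction `∑ q p, ⟪e q, M q p (e p)⟫` of a matrix of operators on `ℂⁿ`. -/
noncomputable def contraction (M : Matrix (Fin n) (Fin n)
    (EuclideanSpace ℂ (Fin n) →L[ℂ] EuclideanSpace ℂ (Fin n))) : ℂ :=
  ∑ q, ∑ p, inner ℂ (EuclideanSpace.single q (1 : ℂ)) (M q p (EuclideanSpace.single p 1))

theorem sum_smul_single (v : EuclideanSpace ℂ (Fin n)) :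
    ∑ q, v q • EuclideanSpace.single q (1 : ℂ) = v := by
  ext i
  simp [Pi.single_apply]

theorem contraction_sandwich (A B : Matrix (Fin k) (Fin n) ℂ) (x : Matrix (Fin k) (Fin k)
    (EuclideanSpace ℂ (Fin n) →L[ℂ] EuclideanSpace ℂ (Fin n))) :
    contraction (sandwich A x B) =
      ∑ i, ∑ j, inner ℂ (WithLp.toLp 2 (A i)) (x i j (WithLp.toLp 2 (B j))) := by
  rw [contraction, sum_inner_sandwich]
  refine Finset.sum_congr rfl fun i _ => Finset.sum_congr rfl fun j _ => ?_
  rw [← sum_smul_single (WithLp.toLp 2 (A i)), ← sum_smul_single (WithLp.toLp 2 (B j))]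

theorem sum_norm_sq_row (A : Matrix (Fin k) (Fin n) ℂ) :
    ∑ i, ‖(WithLp.toLp 2 (A i) : EuclideanSpace ℂ (Fin n))‖ ^ 2 =
      (A.conjTranspose * A).trace.re := by
  simp [trace_conjTranspose_mul_self_re, EuclideanSpace.norm_sq_eq]

open scoped ComplexOrder MatrixOrder in
theorem exists_conjTranspose_mul_self_of_posDef {P : Matrix (Fin n) (Fin n) ℂ} (hP : P.PosDef) :
    ∃ A C : Matrix (Fin n) (Fin n) ℂ, P = A.conjTranspose * A ∧ A * C = 1 ∧ C * A = 1 := by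
  obtain ⟨A, hA⟩ := CStarAlgebra.nonneg_iff_eq_star_mul_self.1 hP.posSemidef.nonneg
  have h1 : IsUnit A.det := by
    have := (Matrix.isUnit_iff_isUnit_det _).1 hP.isUnit
    rw [hA, Matrix.det_mul] at this
    exact isUnit_of_mul_isUnit_right this
  exact ⟨A, A⁻¹, hA, Matrix.mul_nonsing_inv _ h1, Matrix.nonsing_inv_mul _ h1⟩

variable {H : Type u} [NormedAddCommGroup H] [InnerProductSpace ℂ H]
  {K : Type v} [NormedAddCommGroup K] [InnerProductSpace ℂ K]

/-- A linear map into `B(K)` all of whose amplifications have norm at most `c`. -/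
def CBBoundedBy {X : Submodule ℂ (H →L[ℂ] H)} (T : X →ₗ[ℂ] (K →L[ℂ] K)) (c : ℝ) : Prop :=
  ∀ (k : ℕ) (x : Matrix (Fin k) (Fin k) X), matNorm x ≤ 1 → ‖matOp (x.map T)‖ ≤ c

variable {X : Submodule ℂ (H →L[ℂ] H)}
  {T : X →ₗ[ℂ] (EuclideanSpace ℂ (Fin n) →L[ℂ] EuclideanSpace ℂ (Fin n))} {c : ℝ}

open scoped ComplexOrder

/-- With `P = A* A` and `Q = B* B` invertible, `y = A* x B` where `x` has norm at most `1`. The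
contraction of `T y` then pairs the matrix `T x` with the rows of `A` and `B`, whose squared norms
sum to the traces. -/
theorem CBBoundedBy.contraction_le_of_posDef (hT : CBBoundedBy T c) (hc : 0 ≤ c)
    {y : Matrix (Fin n) (Fin n) X} {P Q : Matrix (Fin n) (Fin n) ℂ} (hP : P.PosDef)
    (hQ : Q.PosDef) (h : Dominates P Q (y.map (fun a => (a : H →L[ℂ] H)))) :
    (contraction (y.map T)).re ≤ c * ((P.trace.re + Q.trace.re) / 2) := by
  obtain ⟨A, A', rfl, hA, hA'⟩ := exists_conjTranspose_mul_self_of_posDef hP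
  obtain ⟨B, B', rfl, hB, hB'⟩ := exists_conjTranspose_mul_self_of_posDef hQ
  have hx : matNorm (sandwich A' y B') ≤ 1 := by
    have := norm_matOp_sandwich_le h hA hB
    rwa [← Submodule.coe_subtype, ← sandwich_map] at this
  have h1 := (norm_matOp_le_iff _ hc).1 (hT n _ hx) (fun j => WithLp.toLp 2 (B j))
    (fun i => WithLp.toLp 2 (A i))
  rw [← contraction_sandwich, ← sandwich_map, sandwich_sandwich, hA', hB', sandwich_one,
    sum_norm_sq_row, sum_norm_sq_row] at h1
  linarith

theorem CBBoundedBy.contraction_le (hT : CBBoundedBy T c) (hc : 0 ≤ c)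
    {y : Matrix (Fin n) (Fin n) X} {P Q : Matrix (Fin n) (Fin n) ℂ} (hP : P.PosSemidef)
    (hQ : Q.PosSemidef) (h : Dominates P Q (y.map (fun a => (a : H →L[ℂ] H)))) :
    (contraction (y.map T)).re ≤ c * ((P.trace.re + Q.trace.re) / 2) := by
  -- Adding `ε • 1` to `P` and `Q` makes them invertible; then `ε → 0`.
  have key : ∀ ε : ℝ, 0 < ε →
      (contraction (y.map T)).re ≤ c * ((P.trace.re + Q.trace.re) / 2 + ε * n) := by
    intro ε hε
    have h1 : (ε • (1 : Matrix (Fin n) (Fin n) ℂ)).PosDef := Matrix.PosDef.one.smul hε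
    have h0 : Dominates (ε • (1 : Matrix (Fin n) (Fin n) ℂ)) (ε • (1 : Matrix (Fin n) (Fin n) ℂ))
        (0 : Matrix (Fin n) (Fin n) (H →L[ℂ] H)) := by
      intro ξ η
      simp only [ampForm_smul, ampForm_one, Matrix.zero_apply, _root_.zero_apply, inner_zero_right,
        Finset.sum_const_zero, Complex.zero_re]
      positivity
    have h2 := h.add h0
    rw [add_zero] at h2
    have h3 := hT.contraction_le_of_posDef hc (Matrix.PosDef.posSemidef_add hP h1)
      (Matrix.PosDef.posSemidef_add hQ h1) h2
    refine h3.trans_eq ?_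
    simp only [Matrix.trace_add, Matrix.trace_smul, Matrix.trace_one, Complex.add_re,
      Complex.real_smul, Complex.re_ofReal_mul, Fintype.card_fin, Complex.natCast_re]
    ring
  have hlim : Tendsto (fun ε : ℝ => c * ((P.trace.re + Q.trace.re) / 2 + ε * n)) (𝓝[>] 0)
      (𝓝 (c * ((P.trace.re + Q.trace.re) / 2 + 0 * n))) :=
    Tendsto.mono_left (Continuous.tendsto (by fun_prop) 0) nhdsWithin_le_nhds
  have := ge_of_tendsto hlim (eventually_nhdsWithin_of_forall key)
  simpa using this

theorem CBBoundedBy.contraction_le_traceGauge (hT : CBBoundedBy T c) (hc : 0 ≤ c)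
    (y : Matrix (Fin n) (Fin n) X) :
    (contraction (y.map T)).re ≤ c * traceGauge (y.map (fun a => (a : H →L[ℂ] H))) := by
  rcases hc.eq_or_lt with rfl | hc'
  · obtain ⟨_, P, Q, hP, hQ, h, -⟩ := traceValues_nonempty (y.map (fun a => (a : H →L[ℂ] H)))
    simpa using hT.contraction_le hc hP hQ h
  rw [← div_le_iff₀' hc']
  refine le_csInf (traceValues_nonempty _) ?_
  rintro _ ⟨P, Q, hP, hQ, h, rfl⟩
  rw [div_le_iff₀' hc']
  exact hT.contraction_le hc hP hQ h

/-- The contraction of the amplification of `T`, as a functional on matrices. -/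
noncomputable def contractionFunctional
    (T : (H →L[ℂ] H) →ₗ[ℂ] (EuclideanSpace ℂ (Fin n) →L[ℂ] EuclideanSpace ℂ (Fin n))) :
    Matrix (Fin n) (Fin n) (H →L[ℂ] H) →ₗ[ℂ] ℂ where
  toFun y := contraction (y.map T)
  map_add' y z := by
    simp only [contraction, ← Finset.sum_add_distrib, ← inner_add_right, Matrix.map_apply,
      Matrix.add_apply, map_add, _root_.add_apply]
  map_smul' r y := by
    simp only [contraction, RingHom.id_apply, smul_eq_mul, Finset.mul_sum, ← inner_smul_right,
      Matrix.map_apply, Matrix.smul_apply, map_smul, _root_.smul_apply]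

theorem inner_toEuclideanCLM_single (m : Matrix (Fin n) (Fin n) ℂ) (q p : Fin n) :
    inner ℂ (EuclideanSpace.single q (1 : ℂ))
      (Matrix.toEuclideanCLM (𝕜 := ℂ) m (EuclideanSpace.single p 1)) = m q p := by
  simp [EuclideanSpace.inner_single_left]

theorem toEuclideanCLM_of_inner
    (a : EuclideanSpace ℂ (Fin n) →L[ℂ] EuclideanSpace ℂ (Fin n)) :
    Matrix.toEuclideanCLM (𝕜 := ℂ) (Matrix.of fun q p => inner ℂ (EuclideanSpace.single q (1 : ℂ))
      (a (EuclideanSpace.single p 1))) = a := by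
  obtain ⟨m, rfl⟩ := (Matrix.toEuclideanCLM (n := Fin n) (𝕜 := ℂ)).surjective a
  exact congrArg _ (Matrix.ext fun q p => inner_toEuclideanCLM_single m q p)

/-- **Wittstock's extension theorem** for maps into the `n × n` matrices. -/
theorem CBBoundedBy.exists_extension (hT : CBBoundedBy T c) (hc : 0 ≤ c) :
    ∃ T' : (H →L[ℂ] H) →ₗ[ℂ] (EuclideanSpace ℂ (Fin n) →L[ℂ] EuclideanSpace ℂ (Fin n)),
      (∀ x : X, T' x = T x) ∧ ∀ (k : ℕ) (x : Matrix (Fin k) (Fin k) (H →L[ℂ] H)),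
        ‖matOp x‖ ≤ 1 → ‖matOp (x.map T')‖ ≤ c := by
  -- An arbitrary algebraic extension, whose values matter only on `X`.
  obtain ⟨T₀, hT₀⟩ := LinearMap.exists_extend T
  have hT₀ : ∀ x : X, T₀ x = T x := fun x => LinearMap.congr_fun hT₀ x
  let f : Matrix (Fin n) (Fin n) (H →L[ℂ] H) →ₗ.[ℝ] ℝ :=
    ⟨(Submodule.matrix X).restrictScalars ℝ,
      (Complex.reLm ∘ₗ (contractionFunctional T₀).restrictScalars ℝ).domRestrict _⟩
  obtain ⟨g, hgf, hg⟩ := exists_extension_of_le_sublinear f (fun y => c * traceGauge y)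
    (fun r hr y => by simp only [traceGauge_smul y hr]; ring)
    (fun y z => by
      rw [← mul_add]
      exact mul_le_mul_of_nonneg_left (traceGauge_add y z) hc)
    (by
      rintro ⟨y, hy⟩
      have h1 := hT.contraction_le_traceGauge hc (Matrix.of fun q p => (⟨y q p, hy q p⟩ : X))
      have h2 : (Matrix.of fun q p => (⟨y q p, hy q p⟩ : X)).map T = y.map T₀ :=
        Matrix.ext fun q p => (hT₀ ⟨y q p, hy q p⟩).symm
      rw [h2] at h1
      exact h1)
  let F : Matrix (Fin n) (Fin n) (H →L[ℂ] H) →ₗ[ℂ] ℂ := Module.Dual.extendRCLike (𝕜 := ℂ) g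
  have hF : ∀ y ∈ Submodule.matrix (m := Fin n) (n := Fin n) X,
      F y = contractionFunctional T₀ y := by
    intro y hy
    have h1 : g y = (contractionFunctional T₀ y).re := hgf ⟨y, hy⟩
    -- A complex functional is recovered from its real part at `y` and at `i y`.
    have h2 : g (Complex.I • y) = (contractionFunctional T₀ (Complex.I • y)).re :=
      hgf ⟨Complex.I • y, Submodule.smul_mem _ _ hy⟩
    rw [map_smul (contractionFunctional T₀)] at h2
    refine (Module.Dual.extendRCLike_apply g _).trans ?_
    rw [h1]
    change _ - Complex.I * ((g (Complex.I • y) : ℝ) : ℂ) = _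
    rw [h2]
    apply Complex.ext <;> simp
  have hFre : ∀ y, (F y).re ≤ c * traceGauge y := fun y =>
    (Module.Dual.re_extendRCLike_apply (𝕜 := ℂ) g y).trans_le (hg y)
  let T' : (H →L[ℂ] H) →ₗ[ℂ] (EuclideanSpace ℂ (Fin n) →L[ℂ] EuclideanSpace ℂ (Fin n)) :=
    (Matrix.toEuclideanCLM (n := Fin n) (𝕜 := ℂ)).toAlgEquiv.toLinearMap ∘ₗ
      { toFun := fun a => Matrix.of fun q p => F (Matrix.single q p a)
        map_add' := fun a b => by ext q p; simp [Matrix.single_add]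
        map_smul' := fun r a => by ext q p; simp [← Matrix.smul_single] }
  have hT' : ∀ a, T' a = Matrix.toEuclideanCLM (n := Fin n) (𝕜 := ℂ)
      (Matrix.of fun q p => F (Matrix.single q p a)) := fun _ => rfl
  have hcon : ∀ y : Matrix (Fin n) (Fin n) (H →L[ℂ] H), contraction (y.map T') = F y := by
    intro y
    conv_rhs => rw [Matrix.matrix_eq_sum_single y]
    simp only [contraction, Matrix.map_apply, hT', inner_toEuclideanCLM_single, map_sum,
      Matrix.of_apply]
  refine ⟨T', fun x => ?_, fun k x hx => ?_⟩
  · rw [hT', ← toEuclideanCLM_of_inner (T x)]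
    congr 1
    ext q p
    have hmem : Matrix.single q p (x : H →L[ℂ] H) ∈
        Submodule.matrix (m := Fin n) (n := Fin n) X := by
      intro i j
      rw [Matrix.single_apply]
      split_ifs
      exacts [x.2, X.zero_mem]
    rw [Matrix.of_apply, Matrix.of_apply, hF _ hmem, ← hT₀ x]
    change contraction ((Matrix.single q p (x : H →L[ℂ] H)).map T₀) = _
    rw [contraction, Finset.sum_eq_single q, Finset.sum_eq_single p]
    · simp
    · intro j _ hj
      simp [hj.symm]
    · simp
    · intro i _ hi
      simp [hi.symm]
    · simp
  · rw [norm_matOp_le_iff _ hc]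
    intro ξ η
    -- With the test vectors as rows, the sum to be bounded is `F (A* x B)`, and `A* A`, `B* B` are
    -- admissible in the gauge.
    let A : Matrix (Fin k) (Fin n) ℂ := fun i q => η i q
    let B : Matrix (Fin k) (Fin n) ℂ := fun i q => ξ i q
    have h1 := contraction_sandwich A B (x.map T')
    rw [← sandwich_map, hcon] at h1
    have h2 := hFre (sandwich A x B)
    have h3 : traceGauge (sandwich A x B) ≤
        ((A.conjTranspose * A).trace.re + (B.conjTranspose * B).trace.re) / 2 :=
      csInf_le (bddBelow_traceValues _) ⟨_, _, Matrix.posSemidef_conjTranspose_mul_self A,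
        Matrix.posSemidef_conjTranspose_mul_self B, dominates_sandwich A B x hx, rfl⟩
    rw [← sum_norm_sq_row, ← sum_norm_sq_row] at h3
    rw [h1] at h2
    have h4 := h2.trans (mul_le_mul_of_nonneg_left h3 hc)
    refine h4.trans_eq ?_
    change c * ((∑ i, ‖η i‖ ^ 2 + ∑ i, ‖ξ i‖ ^ 2) / 2) = _
    ring

end Extension


/-! ### Compactness and selection of an asymptotic sequence. -/

section Selection

theorem exists_seq_of_eventually_exists {ι α : Type*} [UniformSpace α]
    [(uniformity α).IsCountablyGenerated] [T0Space α] {l : Filter ι} {K : Set α} (hK : IsCompact K)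
    (hne : K.Nonempty) {t : ι → α}
    (h : ∀ V ∈ uniformity α, ∀ᶠ j in l, ∃ s ∈ K, (t j, s) ∈ V) :
    ∃ s : ι → α, (∀ j, s j ∈ K) ∧ Tendsto (fun j => (t j, s j)) l (uniformity α) := by
  let := UniformSpace.metricSpace α
  choose s hs hd using fun j => hK.exists_infDist_eq_dist hne (t j)
  refine ⟨s, hs, tendsto_uniformity_iff_dist_tendsto_zero.2 ?_⟩
  rw [Metric.tendsto_nhds]
  intro ε hε
  filter_upwards [h _ (Metric.dist_mem_uniformity hε)] with j ⟨r, hr, hj⟩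
  rw [Real.dist_0_eq_abs, abs_of_nonneg dist_nonneg, ← hd]
  exact (Metric.infDist_le_dist_of_mem hr).trans_lt hj

/-- `𝒦` is compact by Tychonoff, so along every ultrafilter finer than `atTop` the maps `T j`
converge to a member of `𝒦` vanishing on `X`. Hence `T j` is eventually close to the set of such
members; metrizability yields one sequence serving all neighbourhoods. -/
theorem exists_asymptotic_seq {Y F : Type*} [SeminormedAddCommGroup Y]
    [TopologicalSpace.SeparableSpace Y] [NormedAddCommGroup F] [ProperSpace F] {c : ℝ}
    {𝒦 : Set (Y → F)} (hcl : IsClosed 𝒦) (hc : ∀ S ∈ 𝒦, ∀ y, ‖S y‖ ≤ c * ‖y‖)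
    (hlip : ∀ S ∈ 𝒦, ∀ y z, ‖S y - S z‖ ≤ c * ‖y - z‖) (X : Set Y) (T : ℕ → Y → F)
    (hT : ∀ j, T j ∈ 𝒦) (hT0 : ∀ x ∈ X, Tendsto (fun j => T j x) atTop (𝓝 0)) :
    ∃ S : ℕ → Y → F, (∀ j, S j ∈ 𝒦) ∧ (∀ j, ∀ x ∈ X, S j x = 0) ∧
      ∀ y, Tendsto (fun j => T j y - S j y) atTop (𝓝 0) := by
  have hK : IsCompact 𝒦 := by
    refine (isCompact_univ_pi fun y => isCompact_closedBall (0 : F) (c * ‖y‖)).of_isClosed_subset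
      hcl fun S hS y _ => ?_
    rw [mem_closedBall_zero_iff]
    exact hc S hS y
  let K₀ : Set (Y → F) := 𝒦 ∩ {S | ∀ x ∈ X, S x = 0}
  have hK₀ : IsCompact K₀ := by
    refine hK.inter_right ?_
    simp only [Set.ofPred_forall]
    exact isClosed_iInter fun x => isClosed_iInter fun _ =>
      isClosed_eq (continuous_apply x) continuous_const
  have hlim : ∀ U : Ultrafilter ℕ, (U : Filter ℕ) ≤ atTop →
      ∃ S ∈ K₀, Tendsto T U (𝓝 S) := by
    intro U hU
    obtain ⟨S, hS, hle⟩ := hK.ultrafilter_le_nhds (U.map T)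
      (tendsto_principal.2 (Eventually.of_forall hT))
    refine ⟨S, ⟨hS, fun x hx => ?_⟩, hle⟩
    exact tendsto_nhds_unique (tendsto_pi_nhds.1 hle x) ((hT0 x hx).mono_left hU)
  -- Restriction to a dense sequence lands in `ℕ → F`, whose uniformity is countably generated.
  let d : ℕ → Y := TopologicalSpace.denseSeq Y
  let ρ : (Y → F) → ℕ → F := fun S i => S (d i)
  have hρ : Continuous ρ := by fun_prop
  have hev : ∀ V ∈ uniformity (ℕ → F), ∀ᶠ j in atTop, ∃ s ∈ ρ '' K₀, (ρ (T j), s) ∈ V := by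
    intro V hV
    by_contra hcon
    rw [not_eventually, frequently_iff_neBot] at hcon
    set G : Filter ℕ := atTop ⊓ 𝓟 {j | ¬∃ s ∈ ρ '' K₀, (ρ (T j), s) ∈ V}
    obtain ⟨S, hS, hTS⟩ := hlim (Ultrafilter.of G) ((Ultrafilter.of_le G).trans inf_le_left)
    have h1 : ∀ᶠ j in (Ultrafilter.of G : Filter ℕ), (ρ (T j), ρ S) ∈ V :=
      Uniform.tendsto_nhds_left.1 ((hρ.tendsto S).comp hTS) hV
    have h2 : ∀ᶠ j in (Ultrafilter.of G : Filter ℕ), ¬∃ s ∈ ρ '' K₀, (ρ (T j), s) ∈ V :=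
      ((Ultrafilter.of_le G).trans inf_le_right) (mem_principal_self _)
    obtain ⟨j, hj1, hj2⟩ := (h1.and h2).exists
    exact hj2 ⟨_, ⟨S, hS, rfl⟩, hj1⟩
  obtain ⟨S₀, hS₀, -⟩ := hlim (Ultrafilter.of atTop) (Ultrafilter.of_le _)
  obtain ⟨s, hs, hts⟩ := exists_seq_of_eventually_exists (hK₀.image hρ) ⟨_, S₀, hS₀, rfl⟩ hev
  choose S hS hSs using hs
  refine ⟨S, fun j => (hS j).1, fun j => (hS j).2, fun y => ?_⟩
  have hdense : ∀ i, Tendsto (fun j => ‖T j (d i) - S j (d i)‖) atTop (𝓝 0) := by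
    intro i
    have h1 : Tendsto (fun j => (ρ (T j) i, s j i)) atTop (uniformity F) :=
      Tendsto.comp (Pi.uniformContinuous_proj (fun _ : ℕ => F) i) hts
    rw [tendsto_uniformity_iff_dist_tendsto_zero] at h1
    refine h1.congr fun j => ?_
    rw [← hSs, dist_eq_norm]
  rw [tendsto_zero_iff_norm_tendsto_zero, Metric.tendsto_nhds]
  intro ε hε
  -- `T j` and `S j` each contribute a Lipschitz constant `c`; the `1` keeps the divisor positive.
  have hc1 : 0 < 2 * |c| + 1 := by positivity
  obtain ⟨i, hi⟩ := (TopologicalSpace.denseRange_denseSeq Y).exists_dist_lt y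
    (div_pos (half_pos hε) hc1)
  rw [dist_eq_norm, lt_div_iff₀ hc1] at hi
  filter_upwards [(hdense i).eventually (gt_mem_nhds (half_pos hε))] with j hj
  rw [Real.dist_0_eq_abs, abs_of_nonneg (norm_nonneg _)]
  have h1 := hlip _ (hT j) y (d i)
  have h2 := hlip _ (hS j).1 y (d i)
  have h3 : c * ‖y - d i‖ ≤ |c| * ‖y - d i‖ := by
    gcongr
    exact le_abs_self c
  have h4 : T j y - S j y =
      (T j (d i) - S j (d i)) + ((T j y - T j (d i)) - (S j y - S j (d i))) := by abel
  calc ‖T j y - S j y‖ ≤ ‖T j (d i) - S j (d i)‖ +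
        (‖T j y - T j (d i)‖ + ‖S j y - S j (d i)‖) := by
        rw [h4]
        exact (norm_add_le _ _).trans (by gcongr; exact norm_sub_le _ _)
    _ < ε := by
        have h5 : ‖y - d i‖ * (2 * |c| + 1) = 2 * (|c| * ‖y - d i‖) + ‖y - d i‖ := by ring
        change ‖y - d i‖ * _ < _ at hi
        have h6 := norm_nonneg (y - d i)
        linarith

end Selection


/-! ### Block diagonal operators. -/

section Blocks

variable {E : Type v} [NormedAddCommGroup E] [InnerProductSpace ℂ E]

/-- The `j`-th diagonal block of an operator on `ℓ²(ℕ; E)`. -/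
noncomputable def block (j : ℕ) :
    (lp (fun _ : ℕ => E) 2 →L[ℂ] lp (fun _ : ℕ => E) 2) →ₗ[ℂ] (E →L[ℂ] E) where
  toFun S := (lp.evalCLM ℂ (fun _ : ℕ => E) 2 j) ∘L S ∘L
    (lp.singleContinuousLinearMap ℂ (fun _ : ℕ => E) 2 j)
  map_add' S S' := by ext v; simp
  map_smul' r S := by ext v; simp

theorem block_apply (j : ℕ) (S : lp (fun _ : ℕ => E) 2 →L[ℂ] lp (fun _ : ℕ => E) 2) (v : E) :
    block j S v = S (lp.single 2 j v) j := rfl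

theorem block_eq {S : lp (fun _ : ℕ => E) 2 →L[ℂ] lp (fun _ : ℕ => E) 2} {a : ℕ → E →L[ℂ] E}
    (h : ∀ (ξ : lp (fun _ : ℕ => E) 2) (j : ℕ), S ξ j = a j (ξ j)) (j : ℕ) : block j S = a j := by
  ext v
  rw [block_apply, h]
  congr 1
  exact lp.single_apply_self (E := fun _ : ℕ => E) 2 j v

theorem norm_matOp_block_le {k : ℕ} (j : ℕ)
    (M : Matrix (Fin k) (Fin k) (lp (fun _ : ℕ => E) 2 →L[ℂ] lp (fun _ : ℕ => E) 2)) :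
    ‖matOp (M.map (block j))‖ ≤ ‖matOp M‖ := by
  rw [norm_matOp_le_iff _ (norm_nonneg (matOp M))]
  intro ξ η
  have h := (norm_matOp_le_iff M (norm_nonneg (matOp M))).1 le_rfl
    (fun i => lp.single 2 j (ξ i)) (fun i => lp.single 2 j (η i))
  simp only [lp.inner_single_left, lp.norm_single (E := fun _ : ℕ => E) (p := 2) (by norm_num)] at h
  exact h

/-- Without off-diagonal blocks, the sum-of-squares bounds of the blocks simply add over `j`. -/
theorem norm_matOp_le_of_block {k : ℕ} {c : ℝ} (hc : 0 ≤ c)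
    {M : Matrix (Fin k) (Fin k) (lp (fun _ : ℕ => E) 2 →L[ℂ] lp (fun _ : ℕ => E) 2)}
    {a : ℕ → Matrix (Fin k) (Fin k) (E →L[ℂ] E)}
    (hM : ∀ i l (ξ : lp (fun _ : ℕ => E) 2) (j : ℕ), M i l ξ j = a j i l (ξ j))
    (ha : ∀ j, ‖matOp (a j)‖ ≤ c) : ‖matOp M‖ ≤ c := by
  rw [norm_matOp_le_iff _ hc]
  intro ξ η
  have h1 : HasSum (fun j => (∑ i, ∑ l, inner ℂ (η i j) (a j i l (ξ l j))).re)
      (∑ i, ∑ l, inner ℂ (η i) (M i l (ξ l))).re := by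
    refine Complex.hasSum_re (hasSum_sum fun i _ => hasSum_sum fun l _ => ?_)
    have := lp.hasSum_inner (𝕜 := ℂ) (η i) (M i l (ξ l))
    simpa only [hM] using this
  have hsq : ∀ v : lp (fun _ : ℕ => E) 2, HasSum (fun j => ‖v j‖ ^ 2) (‖v‖ ^ 2) := by
    intro v
    have := lp.hasSum_norm (p := 2) (by norm_num) v
    simpa using this
  have h2 : HasSum (fun j => c / 2 * (∑ i, ‖ξ i j‖ ^ 2 + ∑ i, ‖η i j‖ ^ 2))
      (c / 2 * (∑ i, ‖ξ i‖ ^ 2 + ∑ i, ‖η i‖ ^ 2)) :=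
    ((hasSum_sum fun i _ => hsq (ξ i)).add (hasSum_sum fun i _ => hsq (η i))).mul_left _
  exact hasSum_le (fun j => (norm_matOp_le_iff _ hc).1 (ha j) (fun i => ξ i j) fun i => η i j) h1 h2

end Blocks

/-! ### Completely bounded norms and pointwise limits. -/

section CBNorm

variable {H : Type u} [NormedAddCommGroup H] [InnerProductSpace ℂ H]
  {K : Type v} [NormedAddCommGroup K] [InnerProductSpace ℂ K]
  {X : Submodule ℂ (H →L[ℂ] H)}

theorem matNorm_map_le {Z : Submodule ℂ (K →L[ℂ] K)} {T : X →ₗ[ℂ] Z} (hT : CompletelyBounded T)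
    {k : ℕ} (x : Matrix (Fin k) (Fin k) X) (hx : matNorm x ≤ 1) :
    matNorm (x.map T) ≤ (cbNorm T).toReal := by
  refine (ENNReal.ofReal_le_iff_le_toReal hT.ne).1 ?_
  exact (le_iSup₂ (f := fun (x : Matrix (Fin k) (Fin k) X) (_ : matNorm x ≤ 1) =>
    ENNReal.ofReal (matNorm (x.map T))) x hx).trans (le_iSup (ampNorm T) k)

theorem cbNorm_le {Z : Submodule ℂ (K →L[ℂ] K)} {T : X →ₗ[ℂ] Z} {c : ℝ}
    (h : ∀ (k : ℕ) (x : Matrix (Fin k) (Fin k) X), matNorm x ≤ 1 → matNorm (x.map T) ≤ c) :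
    cbNorm T ≤ ENNReal.ofReal c :=
  iSup_le fun k => iSup₂_le fun x hx => ENNReal.ofReal_le_ofReal (h k x hx)

theorem norm_matOp_const_le_one {a : H →L[ℂ] H} (ha : ‖a‖ ≤ 1) :
    ‖matOp (Matrix.of fun _ _ : Fin 1 => a)‖ ≤ 1 := by
  refine (norm_matOp_le_iff _ zero_le_one).2 fun ξ η => ?_
  simp only [Fin.sum_univ_one, Matrix.of_apply]
  have h1 : (inner ℂ (η 0) (a (ξ 0))).re ≤ ‖η 0‖ * ‖a (ξ 0)‖ := re_inner_le_norm (𝕜 := ℂ) _ _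
  have h2 : ‖a (ξ 0)‖ ≤ 1 * ‖ξ 0‖ := a.le_of_opNorm_le ha _
  refine h1.trans ?_
  nlinarith [sq_nonneg (‖ξ 0‖ - ‖η 0‖), mul_le_mul_of_nonneg_left h2 (norm_nonneg (η 0))]

theorem CBBoundedBy.norm_apply_le_of_norm_le_one {T : X →ₗ[ℂ] (K →L[ℂ] K)} {c : ℝ}
    (hT : CBBoundedBy T c) (x : X) (hx : ‖(x : H →L[ℂ] H)‖ ≤ 1) : ‖T x‖ ≤ c := by
  have h1 : matNorm (Matrix.of fun _ _ : Fin 1 => x) ≤ 1 := by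
    have h : (Matrix.of fun _ _ : Fin 1 => x).map (fun a => (a : H →L[ℂ] H)) =
      Matrix.of fun _ _ : Fin 1 => (x : H →L[ℂ] H) := rfl
    rw [matNorm, h]
    exact norm_matOp_const_le_one hx
  have h2 := hT 1 _ h1
  have h3 := norm_apply_le_norm_matOp ((Matrix.of fun _ _ : Fin 1 => x).map T) 0 0
  rw [Matrix.map_apply, Matrix.of_apply] at h3
  exact h3.trans h2

theorem CBBoundedBy.norm_apply_le {T : X →ₗ[ℂ] (K →L[ℂ] K)} {c : ℝ} (hT : CBBoundedBy T c)
    (x : X) : ‖T x‖ ≤ c * ‖x‖ := by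
  change _ ≤ c * ‖(x : H →L[ℂ] H)‖
  rcases eq_or_ne x 0 with rfl | hx
  · rw [map_zero, norm_zero, ZeroMemClass.coe_zero, norm_zero, mul_zero]
  have h1 : 0 < ‖(x : H →L[ℂ] H)‖ := norm_pos_iff.2 fun h => hx (Subtype.ext h)
  set r : ℝ := ‖(x : H →L[ℂ] H)‖⁻¹ with hr
  have h2 : ‖(r : ℂ)‖ = r := by
    rw [Complex.norm_real, Real.norm_of_nonneg (inv_nonneg.2 h1.le)]
  have h4 := hT.norm_apply_le_of_norm_le_one ((r : ℂ) • x) (by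
    rw [Submodule.coe_smul, norm_smul, h2, inv_mul_cancel₀ h1.ne'])
  rwa [map_smul, norm_smul, h2, hr, ← div_eq_inv_mul, div_le_iff₀ h1] at h4

theorem CBBoundedBy.sub {T S : X →ₗ[ℂ] (K →L[ℂ] K)} {c d : ℝ} (hT : CBBoundedBy T c)
    (hS : CBBoundedBy S d) : CBBoundedBy (T - S) (c + d) := by
  intro k x hx
  have h : matOp (x.map ⇑(T - S)) = matOp (x.map T) - matOp (x.map S) := by
    ext ξ i
    simp [matOp_apply]
  rw [h]
  exact (norm_sub_le (matOp (x.map T)) (matOp (x.map S))).trans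
    (add_le_add (hT k x hx) (hS k x hx))

/-- Linearity and each instance of the sum-of-squares bound involve only finitely many values of
`S`, so they are closed conditions for pointwise convergence. -/
theorem isClosed_cbBoundedBy (X : Submodule ℂ (H →L[ℂ] H)) (K : Type v) [NormedAddCommGroup K]
    [InnerProductSpace ℂ K] {c : ℝ} (hc : 0 ≤ c) :
    IsClosed {S : X → (K →L[ℂ] K) | ∃ S' : X →ₗ[ℂ] (K →L[ℂ] K), CBBoundedBy S' c ∧ ⇑S' = S} := by
  have h : {S : X → (K →L[ℂ] K) | ∃ S' : X →ₗ[ℂ] (K →L[ℂ] K), CBBoundedBy S' c ∧ ⇑S' = S} =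
      {S | ∀ x y, S (x + y) = S x + S y} ∩ {S | ∀ (r : ℂ) (x : X), S (r • x) = r • S x} ∩
      {S | ∀ (k : ℕ) (x : Matrix (Fin k) (Fin k) X), matNorm x ≤ 1 → ∀ ξ η : Fin k → K,
        (∑ i, ∑ j, inner ℂ (η i) (S (x i j) (ξ j))).re ≤
          c / 2 * (∑ i, ‖ξ i‖ ^ 2 + ∑ i, ‖η i‖ ^ 2)} := by
    ext S
    constructor
    · rintro ⟨S', hS', rfl⟩
      exact ⟨⟨map_add S', map_smul S'⟩, fun k x hx => (norm_matOp_le_iff _ hc).1 (hS' k x hx)⟩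
    · rintro ⟨⟨h1, h2⟩, h3⟩
      exact ⟨{ toFun := S, map_add' := h1, map_smul' := h2 },
        fun k x hx => (norm_matOp_le_iff _ hc).2 (h3 k x hx), rfl⟩
  rw [h]
  simp only [Set.ofPred_forall]
  refine IsClosed.inter (IsClosed.inter ?_ ?_) ?_
  · exact isClosed_iInter fun x => isClosed_iInter fun y => isClosed_eq (by fun_prop) (by fun_prop)
  · exact isClosed_iInter fun x => isClosed_iInter fun y => isClosed_eq (by fun_prop) (by fun_prop)
  · refine isClosed_iInter fun k => isClosed_iInter fun x => isClosed_iInter fun _ =>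
      isClosed_iInter fun ξ => isClosed_iInter fun η => isClosed_le ?_ continuous_const
    refine Complex.continuous_re.comp (continuous_finsetSum _ fun i _ =>
      continuous_finsetSum _ fun j _ => ?_)
    have : Continuous fun S : X → (K →L[ℂ] K) => S (x i j) (ξ j) :=
      (continuous_apply (x i j)).clm_apply continuous_const
    fun_prop

end CBNorm

end OpSpace

/-! ### The extension into `c₀(M_n)`. -/

theorem corollary2p21 (n : ℕ) :
    OpSpace.HasCSEP.{u, 0} 2 (OpSpace.cZero (OpSpace.matSpace n)) := by
  intro H _ _ _ Y _ _ X _ hXY T hT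
  set c := (OpSpace.cbNorm T).toReal with hc_def
  have hc : 0 ≤ c := ENNReal.toReal_nonneg
  let Tj : ℕ → X →ₗ[ℂ] (EuclideanSpace ℂ (Fin n) →L[ℂ] EuclideanSpace ℂ (Fin n)) := fun j =>
    OpSpace.block j ∘ₗ Submodule.subtype _ ∘ₗ T
  have hTj : ∀ j, OpSpace.CBBoundedBy (Tj j) c := fun j k x hx =>
    (OpSpace.norm_matOp_block_le j _).trans (OpSpace.matNorm_map_le hT x hx)
  have hTapp : ∀ x : X, Tendsto (fun j => Tj j x) atTop (𝓝 0) ∧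
      ∀ (ξ : lp (fun _ : ℕ => EuclideanSpace ℂ (Fin n)) 2) (j : ℕ),
        (T x).1 ξ j = Tj j x (ξ j) := by
    intro x
    obtain ⟨a, -, ha0, ha⟩ := (T x).2
    have hTa : ∀ j, Tj j x = a j := fun j => OpSpace.block_eq ha j
    refine ⟨?_, fun ξ j => by rw [hTa, ha]⟩
    simp only [hTa]
    exact tendsto_zero_iff_norm_tendsto_zero.2 ha0
  choose T₁ hT₁ hT₁c using fun j => (hTj j).exists_extension hc
  let R : ℕ → Y →ₗ[ℂ] (EuclideanSpace ℂ (Fin n) →L[ℂ] EuclideanSpace ℂ (Fin n)) :=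
    fun j => T₁ j ∘ₗ Y.subtype
  have hR : ∀ j, OpSpace.CBBoundedBy (R j) c := fun j k y hy => hT₁c j k _ hy
  have hRX : ∀ j (x : X), R j (Submodule.inclusion hXY x) = Tj j x := fun j x => hT₁ j x
  obtain ⟨S, hS, hSX, hlim⟩ := OpSpace.exists_asymptotic_seq
    (OpSpace.isClosed_cbBoundedBy Y (EuclideanSpace ℂ (Fin n)) hc)
    (by rintro _ ⟨S, hS, rfl⟩ y; exact hS.norm_apply_le y)
    (by rintro _ ⟨S, hS, rfl⟩ y z; rw [← map_sub]; exact hS.norm_apply_le _)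
    (Set.range (Submodule.inclusion hXY)) (fun j => R j) (fun j => ⟨R j, hR j, rfl⟩)
    (by
      rintro _ ⟨x, rfl⟩
      simp only [hRX]
      exact (hTapp x).1)
  choose S' hS'c hS' using hS
  -- The correction `S' j` vanishes on `X`, so it leaves the extension intact while making the
  -- blocks a null sequence.
  let D : ℕ → Y →ₗ[ℂ] (EuclideanSpace ℂ (Fin n) →L[ℂ] EuclideanSpace ℂ (Fin n)) :=
    fun j => R j - S' j
  have hD : ∀ j y, D j y = R j y - S j y := by
    intro j y
    rw [← hS']
    rfl
  have hnull : ∀ y, Tendsto (fun j => ‖D j y‖) atTop (𝓝 0) := by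
    intro y
    rw [← tendsto_zero_iff_norm_tendsto_zero]
    simpa only [hD] using hlim y
  choose Q hQmem hQ using fun y =>
    OpSpace.exists_mem_cZero (OpSpace.matSpace n) (fun j => D j y)
      (fun _ => Submodule.mem_top) (hnull y)
  let T' : Y →ₗ[ℂ] OpSpace.cZero (OpSpace.matSpace n) :=
    { toFun := fun y => ⟨Q y, hQmem y⟩
      map_add' := fun y z => by
        ext ξ : 3
        ext j : 2
        simp only [hQ, map_add, Submodule.coe_add, add_apply, lp.coeFn_add, Pi.add_apply]
      map_smul' := fun r y => by
        ext ξ : 3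
        ext j : 2
        simp [hQ] }
  have hcb : OpSpace.cbNorm T' ≤ ENNReal.ofReal (c + c) := by
    refine OpSpace.cbNorm_le fun k y hy => ?_
    exact OpSpace.norm_matOp_le_of_block (add_nonneg hc hc)
      (a := fun j => y.map (D j)) (fun i l ξ j => hQ (y i l) ξ j)
      (fun j => (hR j).sub (hS'c j) k y hy)
  refine ⟨T', fun x => ?_, hcb.trans_lt ENNReal.ofReal_lt_top, hcb.trans_eq ?_⟩
  · ext ξ : 3
    refine funext fun j => (hQ _ ξ j).trans ?_
    rw [hD, hSX j _ ⟨x, rfl⟩, sub_zero, hRX, (hTapp x).2]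
  · rw [← two_mul, ENNReal.ofReal_mul zero_le_two, hc_def, ENNReal.ofReal_toReal hT.ne]
    simp
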